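/- Let $n,m\ge 0$ be integers, let $\omega_0,\dots,\omega_m$ be non-negative integers, and let $a_0=1$ and $a_1,\dots,a_m$ be positive integers such that the weighted projective space $\mathbb{P}(1,a_1,\dots,a_m)$ is well-formed, i.e. $\gcd(a_0,\dots,\widehat{a_j},\dots,a_m)=1$ for every $0\le j\le m$ (with $\gcd(\emptyset)=0$, so that $m\ge 1$). Let $\mathcal{F}$ be the corresponding weighted bundle over $\mathbb{P}^n$: the quotient variety $$\mathcal{F}=\bigl(\mathbb{C}^{n+m+2}\setminus V(I)\bigr)/(\mathbb{C}^*)^2,\qquad I=(x_0,\dots,x_n)\cap(y_0,\dots,y_m),$$ where $x_0,\dots,x_n,y_0,\dots,y_m$ are the coordinates on $\mathbb{C}^{n+m+2}$ and $(\lambda,\mu)\in(\mathbb{C}^*)^2$ acts by $x_i\mapsto\lambda x_i$, $y_j\mapsto\lambda^{-\omega_j}\mu^{a_j}y_j$. Then $\mathcal{F}$ is covered by the $(n+1)(m+1)$ pairwise distinct open affine patches $$U_{ij}=\{x_iy_j\neq 0\}\subset\mathcal{F},\qquad 0\le i\le n,\ 0\le j\le m,$$ and each $U_{ij}$ is isomorphic,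 as a variety, to the quotient of $\mathbb{C}^{n+m}$ by the cyclic group $\mathbb{Z}_{a_j}$ of type $$\frac1{a_j}\bigl(\underbrace{0,\dots,0}_{n},a_0,a_1,\dots,\widehat{a_j},\dots,a_m\bigr),$$ i.e. by the group of $a_j$-th roots of unity $\varepsilon$ acting on the $n+m$ coordinates of $\mathbb{C}^{n+m}$ by multiplication with $1,\dots,1$ ($n$ times) and $\varepsilon^{a_k}$, $k\neq j$. Here varieties are taken with their Zariski topology and sheaf of regular functions, and the quotient of a variety by a group is the orbit space with the quotient topology, a function on an open subset being regular if its pullback is regular. -/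

import Mathlib

open TopologicalSpace

noncomputable section

/-- A complex space with functions: a topological space with a sheaf of `ℂ`-algebras of
`ℂ`-valued functions. Classical complex algebraic varieties are viewed as such spaces, through
their Zariski topology and their regular functions. The axiom `mem_of_locally` says that
regularity is a local property; it contains both the restriction and the gluing axiom. -/
structure SpaceWithFunctions where
  carrier : Type
  top : TopologicalSpace carrier
  regular : (U : Opens carrier) → Subalgebra ℂ (U → ℂ)
  mem_of_locally : ∀ (U : Opens carrier) (f : U → ℂ),
    (∀ x : U, ∃ V : Opens carrier, (x : carrier) ∈ V ∧ ∃ g ∈ regular V,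
      ∀ (y : U) (hy : (y : carrier) ∈ V), f y = g ⟨y, hy⟩) → f ∈ regular U

namespace SpaceWithFunctions

instance : CoeSort SpaceWithFunctions Type := ⟨carrier⟩

instance (X : SpaceWithFunctions) : TopologicalSpace X := X.top

/-- An isomorphism of spaces with functions: a homeomorphism under which the regular functions
on corresponding open sets correspond to each other. -/
structure Iso (X Y : SpaceWithFunctions) where
  toHomeomorph : X ≃ₜ Y
  regular_iff : ∀ (V : Opens Y) (f : V → ℂ),
    f ∈ Y.regular V ↔
      (fun x : Opens.comap ⟨toHomeomorph, toHomeomorph.continuous⟩ V =>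
        f ⟨toHomeomorph x, x.2⟩) ∈
        X.regular (Opens.comap ⟨toHomeomorph, toHomeomorph.continuous⟩ V)

/-- The structure induced on a subset `S` of `X`: the subspace topology, the regular functions
being those which are locally restrictions of regular functions on open subsets of `X`. For open
`S` it is the open subspace, for closed algebraic `S` the closed subvariety (reduced). -/
def induced (X : SpaceWithFunctions) (S : Set X) : SpaceWithFunctions where
  carrier := S
  top := inferInstance
  regular W :=
    { carrier := {f | ∀ x : W, ∃ V : Opens X, ((x : S) : X) ∈ V ∧ ∃ g ∈ X.regular V,
        ∀ (y : W) (hy : ((y : S) : X) ∈ V), f y = g ⟨((y : S) : X), hy⟩}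
      algebraMap_mem' := fun c x =>
        ⟨⊤, trivial, algebraMap ℂ _ c, Subalgebra.algebraMap_mem _ c, fun _ _ => rfl⟩
      add_mem' := by
        intro f₁ f₂ h₁ h₂ x
        obtain ⟨V₁, hx₁, g₁, hg₁, e₁⟩ := h₁ x
        obtain ⟨V₂, hx₂, g₂, hg₂, e₂⟩ := h₂ x
        refine ⟨V₁ ⊓ V₂, ⟨hx₁, hx₂⟩,
          (fun y : (V₁ ⊓ V₂ : Opens X) => g₁ ⟨y, y.2.1⟩) +
            (fun y : (V₁ ⊓ V₂ : Opens X) => g₂ ⟨y, y.2.2⟩), add_mem ?_ ?_, ?_⟩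
        · exact X.mem_of_locally _ _ fun y => ⟨V₁, y.2.1, g₁, hg₁, fun _ _ => rfl⟩
        · exact X.mem_of_locally _ _ fun y => ⟨V₂, y.2.2, g₂, hg₂, fun _ _ => rfl⟩
        · intro y hy
          simp [e₁ y hy.1, e₂ y hy.2]
      mul_mem' := by
        intro f₁ f₂ h₁ h₂ x
        obtain ⟨V₁, hx₁, g₁, hg₁, e₁⟩ := h₁ x
        obtain ⟨V₂, hx₂, g₂, hg₂, e₂⟩ := h₂ x
        refine ⟨V₁ ⊓ V₂, ⟨hx₁, hx₂⟩,
          (fun y : (V₁ ⊓ V₂ : Opens X) => g₁ ⟨y, y.2.1⟩) *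
            (fun y : (V₁ ⊓ V₂ : Opens X) => g₂ ⟨y, y.2.2⟩), mul_mem ?_ ?_, ?_⟩
        · exact X.mem_of_locally _ _ fun y => ⟨V₁, y.2.1, g₁, hg₁, fun _ _ => rfl⟩
        · exact X.mem_of_locally _ _ fun y => ⟨V₂, y.2.2, g₂, hg₂, fun _ _ => rfl⟩
        · intro y hy
          simp [e₁ y hy.1, e₂ y hy.2] }
  mem_of_locally := by
    intro U f h x
    obtain ⟨V, hxV, g, hg, e⟩ := h x
    obtain ⟨V', hxV', g', hg', e'⟩ := hg ⟨x, hxV⟩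
    obtain ⟨O, hO, hOV⟩ := isOpen_induced_iff.1 V.isOpen
    have hVO : ∀ s : S, s ∈ V ↔ (s : X) ∈ O := fun s => by
      change s ∈ (V : Set S) ↔ _
      rw [← hOV]; rfl
    refine ⟨V' ⊓ ⟨O, hO⟩, ⟨hxV', (hVO _).1 hxV⟩, fun y => g' ⟨y, y.2.1⟩, ?_, ?_⟩
    · exact X.mem_of_locally _ _ fun y => ⟨V', y.2.1, g', hg', fun _ _ => rfl⟩
    · intro y hy
      have hyV : (y : S) ∈ V := (hVO _).2 hy.2
      rw [e y hyV]
      exact e' ⟨y, hyV⟩ hy.1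

/-- The quotient of `X` by an equivalence relation: the set of classes with the quotient topology,
a function on an open set being regular if its pullback to `X` is. When the relation is the
orbit relation of a group action, this is the orbit space with the sheaf of invariant regular
functions, that is, the underlying space with functions of a geometric quotient. -/
def quotient (X : SpaceWithFunctions) (r : Setoid X) : SpaceWithFunctions where
  carrier := Quotient r
  top := inferInstance
  regular U :=
    (X.regular (Opens.comap ⟨Quotient.mk r, continuous_quotient_mk'⟩ U)).comap
      { toFun := fun f (x : Opens.comap ⟨Quotient.mk r, continuous_quotient_mk'⟩ U) =>
          f ⟨Quotient.mk r x, x.2⟩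
        map_one' := rfl
        map_mul' := fun _ _ => rfl
        map_zero' := rfl
        map_add' := fun _ _ => rfl
        commutes' := fun _ => rfl }
  mem_of_locally := by
    intro U f h
    refine X.mem_of_locally _ _ fun x => ?_
    obtain ⟨V, hxV, g, hg, e⟩ := h ⟨Quotient.mk r x, x.2⟩
    exact ⟨Opens.comap ⟨Quotient.mk r, continuous_quotient_mk'⟩ V, hxV, _, hg,
      fun y hy => e ⟨Quotient.mk r y, y.2⟩ hy⟩

end SpaceWithFunctions

/-- The Zariski topology on `ℂ^σ`: the closed sets are the common zero sets of sets of
polynomials. -/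
@[reducible]
def zariskiTopology (σ : Type) : TopologicalSpace (σ → ℂ) :=
  TopologicalSpace.ofClosed
    {Z | ∃ S : Set (MvPolynomial σ ℂ), Z = {x | ∀ p ∈ S, MvPolynomial.eval x p = 0}}
    ⟨{1}, by ext; simp⟩
    (by
      intro A hA
      refine ⟨{p | ∃ Z ∈ A, ∀ x ∈ Z, MvPolynomial.eval x p = 0}, ?_⟩
      ext x
      constructor
      · rintro hx p ⟨Z, hZ, hp⟩
        exact hp x (hx Z hZ)
      · intro hx Z hZ
        obtain ⟨S, rfl⟩ := hA hZ
        exact fun p hp => hx p ⟨_, hZ, fun y hy => hy p hp⟩)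
    (by
      rintro _ ⟨S, rfl⟩ _ ⟨T, rfl⟩
      refine ⟨{p | ∃ s ∈ S, ∃ t ∈ T, p = s * t}, ?_⟩
      ext x
      constructor
      · rintro (hx | hx) p ⟨s, hs, t, ht, rfl⟩
        · simp [hx s hs]
        · simp [hx t ht]
      · intro hx
        by_contra hcon
        simp only [Set.mem_union, Set.mem_ofPred_eq, not_or, not_forall] at hcon
        obtain ⟨⟨s, hs, hs0⟩, ⟨t, ht, ht0⟩⟩ := hcon
        have := hx (s * t) ⟨s, hs, t, ht, rfl⟩
        rw [map_mul] at this
        exact (mul_ne_zero hs0 ht0) this)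

/-- Affine space `ℂ^σ` with the Zariski topology; the regular functions are those which are
locally quotients of polynomials. -/
def affineSpace (σ : Type) : SpaceWithFunctions where
  carrier := σ → ℂ
  top := zariskiTopology σ
  regular U :=
    letI := zariskiTopology σ
    { carrier := {f | ∀ x : U, ∃ V : Opens (σ → ℂ), (x : σ → ℂ) ∈ V ∧
        ∃ p q : MvPolynomial σ ℂ, ∀ y : U, (y : σ → ℂ) ∈ V →
          MvPolynomial.eval (y : σ → ℂ) q ≠ 0 ∧
          f y = MvPolynomial.eval (y : σ → ℂ) p / MvPolynomial.eval (y : σ → ℂ) q}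
      algebraMap_mem' := fun c x =>
        ⟨⊤, trivial, MvPolynomial.C c, 1, fun y _ => by simp⟩
      add_mem' := by
        intro f₁ f₂ h₁ h₂ x
        obtain ⟨V₁, hx₁, p₁, q₁, e₁⟩ := h₁ x
        obtain ⟨V₂, hx₂, p₂, q₂, e₂⟩ := h₂ x
        refine ⟨V₁ ⊓ V₂, ⟨hx₁, hx₂⟩, p₁ * q₂ + q₁ * p₂, q₁ * q₂, fun y hy => ?_⟩
        obtain ⟨n₁, e₁⟩ := e₁ y hy.1
        obtain ⟨n₂, e₂⟩ := e₂ y hy.2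
        refine ⟨by simp [n₁, n₂], ?_⟩
        simp only [Pi.add_apply, e₁, e₂, map_add, map_mul]
        exact div_add_div _ _ n₁ n₂
      mul_mem' := by
        intro f₁ f₂ h₁ h₂ x
        obtain ⟨V₁, hx₁, p₁, q₁, e₁⟩ := h₁ x
        obtain ⟨V₂, hx₂, p₂, q₂, e₂⟩ := h₂ x
        refine ⟨V₁ ⊓ V₂, ⟨hx₁, hx₂⟩, p₁ * p₂, q₁ * q₂, fun y hy => ?_⟩
        obtain ⟨n₁, e₁⟩ := e₁ y hy.1
        obtain ⟨n₂, e₂⟩ := e₂ y hy.2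
        refine ⟨by simp [n₁, n₂], ?_⟩
        simp only [Pi.mul_apply, e₁, e₂, map_mul]
        exact div_mul_div_comm _ _ _ _ }
  mem_of_locally := by
    let _ := zariskiTopology σ
    intro U f h x
    obtain ⟨V, hxV, g, hg, e⟩ := h x
    obtain ⟨V', hxV', p, q, e'⟩ := hg ⟨x, hxV⟩
    refine ⟨V ⊓ V', ⟨hxV, hxV'⟩, p, q, fun y hy => ?_⟩
    rw [e y hy.1]
    exact e' ⟨y, hy.1⟩ hy.2

/-- A space with functions is an affine variety if it is isomorphic to a closed algebraic subset
of some `ℂ^N`. -/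
def SpaceWithFunctions.IsAffine (X : SpaceWithFunctions) : Prop :=
  ∃ (N : ℕ) (I : Ideal (MvPolynomial (Fin N) ℂ)),
    Nonempty (X.Iso ((affineSpace (Fin N)).induced
      {x : Fin N → ℂ | ∀ p ∈ I, MvPolynomial.eval x p = 0}))

/-- The linear action of a group `G` on `ℂ^σ` by `g • x = (χ_j(g) x_j)_j`, for characters
`χ_j : G → ℂˣ`. -/
@[reducible]
def diagonalAction {G : Type} [Group G] {σ : Type} (χ : σ → G →* ℂˣ) : MulAction G (σ → ℂ) where
  smul g x := fun j => (χ j g : ℂ) * x j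
  one_smul x := by
    funext j
    change (χ j 1 : ℂ) * x j = x j
    simp
  mul_smul g h x := by
    funext j
    change (χ j (g * h) : ℂ) * x j = (χ j g : ℂ) * ((χ j h : ℂ) * x j)
    simp [mul_assoc]

/-- The relation of being in the same orbit of the diagonal action. -/
def diagonalOrbitRel {G : Type} [Group G] {σ : Type} (χ : σ → G →* ℂˣ) : Setoid (σ → ℂ) :=
  letI := diagonalAction χ
  MulAction.orbitRel G (σ → ℂ)

/-- The character `λ ↦ ∏ i, λ_i ^ v_i` of the torus `(ℂˣ)^r`. -/
def torusCharacter {r : ℕ} (v : Fin r → ℤ) : (Fin r → ℂˣ) →* ℂˣ where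
  toFun t := ∏ i, t i ^ v i
  map_one' := by simp
  map_mul' s t := by simp [mul_zpow, Finset.prod_mul_distrib]

/-- The complement of the vanishing set `V(I)` in `ℂ^σ`. -/
def nonvanishingLocus {σ : Type} (I : Ideal (MvPolynomial σ ℂ)) : Set (affineSpace σ) :=
  {x : σ → ℂ | ∃ p ∈ I, MvPolynomial.eval x p ≠ 0}

/-- The quotient `(I, A) = (ℂ^σ - V(I)) / (ℂˣ)^r` determined by an irrelevant ideal `I` and an
integer matrix `A`: the element `(λ_1, …, λ_r)` of the torus multiplies the coordinate `x_j` by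
`∏ i, λ_i ^ A_{ij}`. (The ideal `I` is meant to be homogeneous for the grading by the columns of
`A`, so that `ℂ^σ - V(I)` is stable under the torus.) -/
def toricQuotient {r : ℕ} {σ : Type} (I : Ideal (MvPolynomial σ ℂ)) (A : Matrix (Fin r) σ ℤ) :
    SpaceWithFunctions :=
  ((affineSpace σ).induced (nonvanishingLocus I)).quotient
    (Setoid.comap Subtype.val (diagonalOrbitRel fun j => torusCharacter fun i => A i j))

/-- The cyclic quotient `ℂ^N / ℤ_k` of type `1/k (w_1, …, w_N)`: the cyclic group of `k`-th roots
of unity in `ℂ` acts by `ε • (x_1, …, x_N) = (ε^{w_1} x_1, …, ε^{w_N} x_N)`. -/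
def cyclicQuotient {N : ℕ} (k : ℕ) (w : Fin N → ℕ) : SpaceWithFunctions :=
  (affineSpace (Fin N)).quotient
    (diagonalOrbitRel fun j =>
      (powMonoidHom (w j)).comp (rootsOfUnity k ℂ).subtype)

/-- The numerical data of a weighted bundle over `ℙ^n`: non-negative integers `ω_0, …, ω_m` and
positive integers `a_0 = 1, a_1, …, a_m` such that the weighted projective space
`ℙ(1, a_1, …, a_m)` is well-formed. -/
structure WeightedBundle (n m : ℕ) where
  ω : Fin (m + 1) → ℕ
  a : Fin (m + 1) → ℕ
  a_zero : a 0 = 1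
  a_pos : ∀ j, 0 < a j
  wellFormed : ∀ j, (Finset.univ.erase j).gcd a = 1

namespace WeightedBundle

variable {n m : ℕ}

/-- The weight matrix; the index `Sum.inl i` belongs to `x_i` and `Sum.inr j` to `y_j`. -/
def matrix (F : WeightedBundle n m) : Matrix (Fin 2) (Fin (n + 1) ⊕ Fin (m + 1)) ℤ :=
  Matrix.of ![Sum.elim (fun _ => 1) (fun j => -(F.ω j : ℤ)),
    Sum.elim (fun _ => 0) (fun j => (F.a j : ℤ))]

/-- The irrelevant ideal `(x_0, …, x_n) ∩ (y_0, …, y_m)`. -/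
def irrelevantIdeal (_F : WeightedBundle n m) :
    Ideal (MvPolynomial (Fin (n + 1) ⊕ Fin (m + 1)) ℂ) :=
  Ideal.span (Set.range fun i => MvPolynomial.X (Sum.inl i)) ⊓
    Ideal.span (Set.range fun j => MvPolynomial.X (Sum.inr j))

/-- The weighted bundle as a variety: the quotient of `ℂ^{n+m+2} - V(I)` by `(ℂˣ)^2`. -/
def space (F : WeightedBundle n m) : SpaceWithFunctions :=
  toricQuotient F.irrelevantIdeal F.matrix

/-- The class in the quotient of a point of `ℂ^{n+m+2} - V(I)`. -/
def pointClass (F : WeightedBundle n m)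
    (z : (affineSpace (Fin (n + 1) ⊕ Fin (m + 1))).induced
      (nonvanishingLocus F.irrelevantIdeal)) : F.space :=
  Quotient.mk _ z

/-- The patch `U_{ij} = {x_i y_j ≠ 0}` of the weighted bundle. -/
def patch (F : WeightedBundle n m) (i : Fin (n + 1)) (j : Fin (m + 1)) : Set F.space :=
  F.pointClass '' {z | (z.1 : Fin (n + 1) ⊕ Fin (m + 1) → ℂ) (Sum.inl i) *
    (z.1 : Fin (n + 1) ⊕ Fin (m + 1) → ℂ) (Sum.inr j) ≠ 0}

end WeightedBundle

end

/-! The slice `x_i = y_j = 1` is a copy of `ℂ^{n+m}` meeting every torus orbit in `U_{ij}`: `λ`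
normalizes `x_i`, and extracting an `a_j`-th root gives a `μ` that normalizes `y_j`. What remains is
`λ = 1`, `μ ^ a_j = 1`, which acts on the slice with the weights of the cyclic quotient. So
`patchMap` is surjective with the orbits of the `a_j`-th roots of unity as fibres.

To pass from a bijection to an isomorphism, three targets of maps from `ℂ^{n+m}` are compared: the
patch, the cyclic quotient, and the closed set cut out by the relations among generators of the
invariant ring. All three maps are quotient morphisms with the same fibres, so
`IsQuotientMorphism.nonempty_iso` identifies the targets, which gives both the isomorphism type and
affineness.

The criterion `isQuotientMorphism_of_isCyclicInvariant` reduces the quotient property to descent of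
invariant polynomials, because invariant open sets and invariant regular functions are locally
described by such polynomials. This rests on the `ZMod k`-grading by weight: `p (ε • x)` is a
polynomial in `ε` of degree below `k` whose coefficients are the components of `p` at `x`, so
vanishing for all `k`-th roots of unity kills every component. On the patch, descent is
`exists_homogenization`; on the affine model, it is finite generation of the invariants, while
surjectivity there comes from the Nullstellensatz and the projection onto invariants. -/

noncomputable section

/-! ### Morphisms and quotient morphisms of spaces with functions. -/

namespace SpaceWithFunctions

variable {X Y Z : SpaceWithFunctions}

/-- Iterated preimages of an open set may be equal without being definitionally so; this transports
regularity across such an equality. -/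
theorem mem_regular_congr {U V : Opens X} (h : ∀ x, x ∈ U ↔ x ∈ V) {f : U → ℂ} {g : V → ℂ}
    (hfg : ∀ x (hU : x ∈ U) (hV : x ∈ V), f ⟨x, hU⟩ = g ⟨x, hV⟩) :
    f ∈ X.regular U ↔ g ∈ X.regular V := by
  obtain rfl : U = V := Opens.ext (Set.ext h)
  obtain rfl : f = g := funext fun x => hfg x x.2 x.2
  rfl

theorem restrict_mem_regular {U V : Opens X} {f : U → ℂ} (hf : f ∈ X.regular U) (h : V ≤ U) :
    (fun x : V => f ⟨x, h x.2⟩) ∈ X.regular V :=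
  X.mem_of_locally _ _ fun x => ⟨U, h x.2, f, hf, fun _ _ => rfl⟩

/-- A morphism of spaces with functions: a continuous map pulling back regular functions to
regular functions. -/
structure IsMorphism (φ : X → Y) : Prop where
  continuous : Continuous φ
  comp_mem : ∀ (V : Opens Y), ∀ f ∈ Y.regular V,
    (fun x : Opens.comap ⟨φ, continuous⟩ V => f ⟨φ x, x.2⟩) ∈
      X.regular (Opens.comap ⟨φ, continuous⟩ V)

/-- A surjective morphism which determines the topology and the regular functions of its
target. -/
structure IsQuotientMorphism (φ : X → Y) : Prop extends IsMorphism φ where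
  surjective : Function.Surjective φ
  isOpen_of_preimage : ∀ T : Set Y, IsOpen (φ ⁻¹' T) → IsOpen T
  mem_of_comp_mem : ∀ (V : Opens Y) (f : V → ℂ),
    (fun x : Opens.comap ⟨φ, continuous⟩ V => f ⟨φ x, x.2⟩) ∈
      X.regular (Opens.comap ⟨φ, continuous⟩ V) → f ∈ Y.regular V

theorem IsMorphism.comp {ψ : Y → Z} {φ : X → Y} (hψ : IsMorphism ψ) (hφ : IsMorphism φ) :
    IsMorphism (ψ ∘ φ) where
  continuous := hψ.continuous.comp hφ.continuous
  comp_mem V f hf := hφ.comp_mem _ _ (hψ.comp_mem V f hf)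

theorem isQuotientMorphism_mk (r : Setoid X) :
    IsQuotientMorphism (X := X) (Y := X.quotient r) (Quotient.mk r) where
  continuous := continuous_quotient_mk'
  comp_mem _ _ hf := hf
  surjective := Quotient.mk_surjective
  isOpen_of_preimage _ hT := hT
  mem_of_comp_mem _ _ hf := hf

theorem isMorphism_subtype_val (S : Set X) :
    IsMorphism (X := X.induced S) (Y := X) Subtype.val where
  continuous := continuous_subtype_val
  comp_mem V f hf := fun x => ⟨V, x.2, f, hf, fun _ _ => rfl⟩

theorem IsMorphism.codRestrict {φ : X → Y} (hφ : IsMorphism φ) {S : Set Y} (hS : ∀ x, φ x ∈ S) :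
    IsMorphism (X := X) (Y := Y.induced S) (S.codRestrict φ hS) where
  continuous := hφ.continuous.codRestrict hS
  comp_mem V f hf := by
    refine X.mem_of_locally _ _ fun x => ?_
    obtain ⟨U, hxU, g, hg, e⟩ := hf ⟨_, x.2⟩
    exact ⟨_, hxU, _, hφ.comp_mem U g hg, fun y hy => e ⟨_, y.2⟩ hy⟩

/-- Two quotient morphisms with the same fibres have isomorphic targets. -/
theorem IsQuotientMorphism.nonempty_iso {φ : X → Y} {ψ : X → Z} (hφ : IsQuotientMorphism φ)
    (hψ : IsQuotientMorphism ψ) (h : ∀ x y, φ x = φ y ↔ ψ x = ψ y) : Nonempty (Y.Iso Z) := by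
  -- As the fibres agree, the chosen preimage may be replaced by any other.
  have h₁ : ∀ x, ψ (Function.surjInv hφ.surjective (φ x)) = ψ x := fun x =>
    (h _ _).1 (Function.surjInv_eq hφ.surjective _)
  have h₂ : ∀ x, φ (Function.surjInv hψ.surjective (ψ x)) = φ x := fun x =>
    (h _ _).2 (Function.surjInv_eq hψ.surjective _)
  let e : Y ≃ₜ Z :=
    { toFun := fun y => ψ (Function.surjInv hφ.surjective y)
      invFun := fun z => φ (Function.surjInv hψ.surjective z)
      left_inv := fun y => by
        obtain ⟨x, rfl⟩ := hφ.surjective y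
        exact (congrArg _ <| congrArg _ (h₁ x)).trans (h₂ x)
      right_inv := fun z => by
        obtain ⟨x, rfl⟩ := hψ.surjective z
        exact (congrArg _ <| congrArg _ (h₂ x)).trans (h₁ x)
      continuous_toFun := ⟨fun T hT => hφ.isOpen_of_preimage _ <| by
        have : φ ⁻¹' ((fun y => ψ (Function.surjInv hφ.surjective y)) ⁻¹' T) = ψ ⁻¹' T := by
          ext x
          simp only [Set.mem_preimage, h₁]
        rw [this]
        exact hT.preimage hψ.continuous⟩
      continuous_invFun := ⟨fun T hT => hψ.isOpen_of_preimage _ <| by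
        have : ψ ⁻¹' ((fun y => φ (Function.surjInv hψ.surjective y)) ⁻¹' T) = φ ⁻¹' T := by
          ext x
          simp only [Set.mem_preimage, h₂]
        rw [this]
        exact hT.preimage hφ.continuous⟩ }
  have he : ∀ x, e (φ x) = ψ x := h₁
  have key : ∀ (V : Opens Z) (f : V → ℂ),
      (fun x : Opens.comap ⟨ψ, hψ.continuous⟩ V => f ⟨ψ x, x.2⟩) ∈
        X.regular (Opens.comap ⟨ψ, hψ.continuous⟩ V) ↔
      (fun x : Opens.comap ⟨φ, hφ.continuous⟩ (Opens.comap ⟨e, e.continuous⟩ V) =>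
        f ⟨e (φ x), x.2⟩) ∈
        X.regular (Opens.comap ⟨φ, hφ.continuous⟩ (Opens.comap ⟨e, e.continuous⟩ V)) := by
    intro V f
    refine mem_regular_congr (fun x => ?_) fun x _ _ => ?_
    · change ψ x ∈ V ↔ e (φ x) ∈ V
      rw [he]
    · simp only [he]
  exact ⟨e, fun V f => ⟨fun hf => hφ.mem_of_comp_mem _ _ ((key V f).1 (hψ.comp_mem _ _ hf)),
    fun hf => hψ.mem_of_comp_mem _ _ ((key V f).2 (hφ.comp_mem _ _ hf))⟩⟩

/-- The property that regular functions have open nonvanishing loci, on which they are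
invertible. -/
structure IsLocallyRinged (X : SpaceWithFunctions) : Prop where
  isOpen_ne_zero : ∀ (U : Opens X), ∀ f ∈ X.regular U, IsOpen {x : X | ∃ h : x ∈ U, f ⟨x, h⟩ ≠ 0}
  inv_mem : ∀ (U : Opens X), ∀ f ∈ X.regular U, (∀ x, f x ≠ 0) → (fun x => (f x)⁻¹) ∈ X.regular U

theorem IsLocallyRinged.induced (hX : X.IsLocallyRinged) (S : Set X) :
    (X.induced S).IsLocallyRinged where
  isOpen_ne_zero U f hf := by
    refine isOpen_iff_mem_nhds.2 fun x ⟨hxU, hx⟩ => ?_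
    obtain ⟨V, hxV, g, hg, e⟩ := hf ⟨x, hxU⟩
    have h₁ := (hX.isOpen_ne_zero V g hg).preimage (continuous_subtype_val (p := (· ∈ S)))
    refine Filter.mem_of_superset ((h₁.inter U.isOpen).mem_nhds ⟨⟨hxV, ?_⟩, hxU⟩) ?_
    · rwa [← e ⟨x, hxU⟩ hxV]
    · rintro y ⟨⟨hyV, hy⟩, hyU⟩
      exact ⟨hyU, fun h0 => hy ((e ⟨y, hyU⟩ hyV).symm.trans h0)⟩
  inv_mem U f hf hne x := by
    obtain ⟨V, hxV, g, hg, e⟩ := hf x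
    have hW : ({y : X | ∃ h : y ∈ V, g ⟨y, h⟩ ≠ 0}) ⊆ V := fun y hy => hy.1
    -- The local extension `g` may vanish at points of `V` outside `S`, so `V` is shrunk to its
    -- nonvanishing locus.
    refine ⟨⟨_, hX.isOpen_ne_zero V g hg⟩, ⟨hxV, ?_⟩, _,
      hX.inv_mem _ _ (restrict_mem_regular hg hW) fun y => y.2.2, fun y hy => ?_⟩
    · rw [← e x hxV]
      exact hne x
    · change (f y)⁻¹ = _
      rw [e y hy.1]

theorem IsLocallyRinged.quotient (hX : X.IsLocallyRinged) (r : Setoid X) :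
    (X.quotient r).IsLocallyRinged where
  isOpen_ne_zero _ _ hf := hX.isOpen_ne_zero _ _ hf
  inv_mem _ _ hf hne := hX.inv_mem _ _ hf fun x => hne ⟨Quotient.mk r x, x.2⟩

end SpaceWithFunctions

/-! ### Affine space and polynomial maps. -/

open MvPolynomial SpaceWithFunctions

variable {σ τ : Type}

/-- Evaluation of polynomials at a point of affine space. -/
def evalAt (x : affineSpace σ) : MvPolynomial σ ℂ →+* ℂ := eval (x : σ → ℂ)

theorem evalAt_X (x : affineSpace σ) (i : σ) : evalAt x (X i) = (x : σ → ℂ) i :=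
  eval_X i

theorem evalAt_C (x : affineSpace σ) (a : ℂ) : evalAt x (C a) = a :=
  eval_C a

theorem evalAt_monomial (x : affineSpace σ) (d : σ →₀ ℕ) (a : ℂ) :
    evalAt x (monomial d a) = a * d.prod fun i e => evalAt x (X i) ^ e := by
  simp only [evalAt_X]
  exact eval_monomial

theorem affineSpace_isOpen_iff {U : Set (affineSpace σ)} :
    IsOpen U ↔ ∀ x ∈ U, ∃ p : MvPolynomial σ ℂ, evalAt x p ≠ 0 ∧
      ∀ y : affineSpace σ, evalAt y p ≠ 0 → y ∈ U := by
  constructor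
  · intro hU x hx
    obtain ⟨S, hS⟩ : ∃ S : Set (MvPolynomial σ ℂ), Uᶜ = {x | ∀ p ∈ S, evalAt x p = 0} := hU
    have hx' : x ∉ Uᶜ := fun h => h hx
    rw [hS] at hx'
    change ¬ ∀ p ∈ S, _ at hx'
    push Not at hx'
    obtain ⟨p, hp, hpx⟩ := hx'
    refine ⟨p, hpx, fun y hy => ?_⟩
    by_contra hyU
    have hy' : y ∈ Uᶜ := hyU
    rw [hS] at hy'
    exact hy (hy' p hp)
  · intro h
    change ∃ S : Set (MvPolynomial σ ℂ), Uᶜ = {x | ∀ p ∈ S, evalAt x p = 0}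
    refine ⟨{p | ∀ y : affineSpace σ, evalAt y p ≠ 0 → y ∈ U}, ?_⟩
    ext x
    constructor
    · intro hx p hp
      by_contra hpx
      exact hx (hp x hpx)
    · intro hx hxU
      obtain ⟨p, hpx, hp⟩ := h x hxU
      exact hpx (hx p hp)

theorem isOpen_evalAt_ne_zero (p : MvPolynomial σ ℂ) :
    IsOpen {x : affineSpace σ | evalAt x p ≠ 0} :=
  affineSpace_isOpen_iff.2 fun _ hx => ⟨p, hx, fun _ hy => hy⟩

/-- A local fraction `p / q` becomes an identity on all of `U` after multiplying `p` and `q` by a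
polynomial that vanishes outside the small neighbourhood: there both sides are zero. -/
theorem mem_affineSpace_regular_iff {U : Opens (affineSpace σ)} {f : U → ℂ} :
    f ∈ (affineSpace σ).regular U ↔ ∀ x : U, ∃ p q : MvPolynomial σ ℂ,
      evalAt (x : affineSpace σ) q ≠ 0 ∧
        ∀ y : U, f y * evalAt (y : affineSpace σ) q = evalAt (y : affineSpace σ) p := by
  constructor
  · intro hf x
    obtain ⟨(V : Opens (affineSpace σ)), hxV, p, q, e⟩ := hf x
    obtain ⟨h, hx, hV⟩ := affineSpace_isOpen_iff.1 V.isOpen x hxV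
    refine ⟨p * h, q * h, ?_, fun y => ?_⟩
    · rw [map_mul]
      exact mul_ne_zero (e x hxV).1 hx
    · by_cases hy : evalAt (y : affineSpace σ) h = 0
      · simp [hy]
      · obtain ⟨hq, hf⟩ := e y (hV y hy)
        change evalAt (y : affineSpace σ) q ≠ 0 at hq
        change f y = evalAt (y : affineSpace σ) p / evalAt (y : affineSpace σ) q at hf
        rw [hf, map_mul, map_mul]
        field_simp
  · intro hf x
    obtain ⟨p, q, hq, e⟩ := hf x
    exact ⟨(⟨_, isOpen_evalAt_ne_zero q⟩ : Opens (affineSpace σ)), hq, p, q, fun y hy =>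
      ⟨hy, eq_div_of_mul_eq hy (e y)⟩⟩

theorem evalAt_mem_affineSpace_regular (p : MvPolynomial σ ℂ) (U : Opens (affineSpace σ)) :
    (fun x : U => evalAt (x : affineSpace σ) p) ∈ (affineSpace σ).regular U :=
  mem_affineSpace_regular_iff.2 fun _ => ⟨p, 1, by simp, fun _ => by simp⟩

theorem affineSpace_isLocallyRinged (σ : Type) : (affineSpace σ).IsLocallyRinged where
  isOpen_ne_zero U f hf := by
    refine affineSpace_isOpen_iff.2 fun x ⟨hxU, hx⟩ => ?_
    obtain ⟨p, q, hq, e⟩ := mem_affineSpace_regular_iff.1 hf ⟨x, hxU⟩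
    obtain ⟨h, hh, hU⟩ := affineSpace_isOpen_iff.1 U.isOpen x hxU
    refine ⟨p * h, ?_, fun y hy => ?_⟩
    · rw [map_mul, ← e ⟨x, hxU⟩]
      exact mul_ne_zero (mul_ne_zero hx hq) hh
    · rw [map_mul] at hy
      have hyU := hU y (right_ne_zero_of_mul hy)
      refine ⟨hyU, fun h0 => left_ne_zero_of_mul hy ?_⟩
      rw [← e ⟨y, hyU⟩, h0, zero_mul]
  inv_mem U f hf hne := by
    refine mem_affineSpace_regular_iff.2 fun x => ?_
    obtain ⟨p, q, hq, e⟩ := mem_affineSpace_regular_iff.1 hf x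
    refine ⟨q, p, ?_, fun y => ?_⟩
    · rw [← e x]
      exact mul_ne_zero (hne x) hq
    · rw [← e y, inv_mul_cancel_left₀ (hne y)]

/-- The polynomial map with components `g`. -/
def polynomialMap (g : τ → MvPolynomial σ ℂ) : affineSpace σ → affineSpace τ :=
  fun x i => evalAt x (g i)

theorem evalAt_polynomialMap (g : τ → MvPolynomial σ ℂ) (x : affineSpace σ) (p : MvPolynomial τ ℂ) :
    evalAt (polynomialMap g x) p = evalAt x (aeval g p) := by
  induction p using MvPolynomial.induction_on with
  | C a => rw [algHom_C, algebraMap_eq, evalAt_C, evalAt_C]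
  | add p q hp hq => simp only [map_add, hp, hq]
  | mul_X p i hp =>
    rw [map_mul, hp, map_mul, map_mul, aeval_X, evalAt_X]
    rfl

theorem isMorphism_polynomialMap (g : τ → MvPolynomial σ ℂ) :
    SpaceWithFunctions.IsMorphism (polynomialMap g) where
  continuous := ⟨fun U hU => affineSpace_isOpen_iff.2 fun x hx => by
    obtain ⟨p, hp, h⟩ := affineSpace_isOpen_iff.1 hU _ hx
    refine ⟨aeval g p, by rwa [← evalAt_polynomialMap], fun y hy => h _ ?_⟩
    rwa [evalAt_polynomialMap]⟩
  comp_mem V f hf := by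
    refine mem_affineSpace_regular_iff.2 fun x => ?_
    obtain ⟨p, q, hq, e⟩ := mem_affineSpace_regular_iff.1 hf ⟨_, x.2⟩
    refine ⟨aeval g p, aeval g q, by rwa [← evalAt_polynomialMap], fun y => ?_⟩
    rw [← evalAt_polynomialMap, ← evalAt_polynomialMap]
    exact e ⟨_, y.2⟩

/-! ### Actions of roots of unity. -/

/-- The weights `w` modulo `k`. -/
abbrev weightMod (k : ℕ) (w : σ → ℕ) : σ → ZMod k := fun i => (w i : ZMod k)

/-- The polynomials which are invariant under the diagonal action of the `k`-th roots of unity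
with weights `w`. -/
abbrev IsCyclicInvariant (k : ℕ) (w : σ → ℕ) (p : MvPolynomial σ ℂ) : Prop :=
  IsWeightedHomogeneous (weightMod k w) p 0

/-- The point `(ε ^ w_i * x_i)_i`. -/
def weightedScale (w : σ → ℕ) (ε : ℂ) (x : affineSpace σ) : affineSpace σ :=
  fun i => ε ^ w i * (x : σ → ℂ) i

theorem evalAt_weightedScale_X (w : σ → ℕ) (ε : ℂ) (x : affineSpace σ) (i : σ) :
    evalAt (weightedScale w ε x) (X i) = ε ^ w i * evalAt x (X i) := by
  rw [evalAt_X, evalAt_X]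
  rfl

theorem weightedScale_mul (w : σ → ℕ) (ε δ : ℂ) (x : affineSpace σ) :
    weightedScale w (ε * δ) x = weightedScale w ε (weightedScale w δ x) := by
  funext i
  change (ε * δ) ^ w i * (x : σ → ℂ) i = ε ^ w i * (δ ^ w i * (x : σ → ℂ) i)
  rw [mul_pow, mul_assoc]

theorem weightedScale_one (w : σ → ℕ) (x : affineSpace σ) : weightedScale w 1 x = x := by
  funext i
  change 1 ^ w i * (x : σ → ℂ) i = (x : σ → ℂ) i
  rw [one_pow, one_mul]

theorem weightedScale_inv_cancel (w : σ → ℕ) {ε : ℂ} (hε : ε ≠ 0) (x : affineSpace σ) :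
    weightedScale w ε⁻¹ (weightedScale w ε x) = x := by
  rw [← weightedScale_mul, inv_mul_cancel₀ hε, weightedScale_one]

theorem ne_zero_of_pow_eq_one {k : ℕ} [NeZero k] {ε : ℂ} (hε : ε ^ k = 1) : ε ≠ 0 := by
  rintro rfl
  rw [zero_pow (NeZero.ne k)] at hε
  exact zero_ne_one hε

theorem diagonalOrbitRel_rootsOfUnity_iff {k : ℕ} [NeZero k] {w : σ → ℕ} {x y : affineSpace σ} :
    (diagonalOrbitRel fun j => (powMonoidHom (w j)).comp (rootsOfUnity k ℂ).subtype) x y ↔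
      ∃ ε : ℂ, ε ^ k = 1 ∧ x = weightedScale w ε y := by
  constructor
  · rintro ⟨⟨ε, hε⟩, rfl⟩
    refine ⟨ε, (mem_rootsOfUnity' k ε).1 hε, funext fun j => ?_⟩
    change ((ε ^ w j : ℂˣ) : ℂ) * (y : σ → ℂ) j = (ε : ℂ) ^ w j * (y : σ → ℂ) j
    rw [Units.val_pow_eq_pow_val]
  · rintro ⟨ε, hε, rfl⟩
    refine ⟨⟨Units.mk0 ε (ne_zero_of_pow_eq_one hε), (mem_rootsOfUnity' k _).2 hε⟩,
      funext fun j => ?_⟩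
    change ((Units.mk0 ε (ne_zero_of_pow_eq_one hε) ^ w j : ℂˣ) : ℂ) * (y : σ → ℂ) j =
      ε ^ w j * (y : σ → ℂ) j
    rw [Units.val_pow_eq_pow_val, Units.val_mk0]

theorem pow_eq_pow_val {k : ℕ} {ε : ℂ} (hε : ε ^ k = 1) (d : ℕ) :
    ε ^ d = ε ^ (d : ZMod k).val := by
  rw [ZMod.val_natCast, pow_eq_pow_mod d hε]

/-- A polynomial expression of degree less than `k` which vanishes at all `k`-th roots of unity
is zero. -/
theorem eq_zero_of_sum_pow_val_mul {k : ℕ} [NeZero k] (b : ZMod k → ℂ)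
    (h : ∀ ε : ℂ, ε ^ k = 1 → ∑ c, ε ^ c.val * b c = 0) (c : ZMod k) : b c = 0 := by
  let P : Polynomial ℂ := ∑ c : ZMod k, Polynomial.monomial c.val (b c)
  have hP : P = 0 := by
    refine Polynomial.eq_zero_of_natDegree_lt_card_of_eval_eq_zero' P
      (Polynomial.nthRootsFinset k (1 : ℂ)) (fun ε hε => ?_) ?_
    · rw [Polynomial.mem_nthRootsFinset (NeZero.pos k)] at hε
      rw [Polynomial.eval_finsetSum, ← h ε hε]
      exact Finset.sum_congr rfl fun c _ => by rw [Polynomial.eval_monomial, mul_comm]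
    · rw [(Complex.isPrimitiveRoot_exp k (NeZero.ne k)).card_nthRootsFinset]
      refine lt_of_le_of_lt (Polynomial.natDegree_sum_le_of_forall_le (n := k - 1) _ _
        fun c _ => ?_) (Nat.sub_lt (NeZero.pos k) one_pos)
      exact (Polynomial.natDegree_monomial_le _).trans (Nat.le_sub_one_of_lt c.val_lt)
  have hc : P.coeff c.val = b c := by
    rw [Polynomial.finsetSum_coeff, Finset.sum_eq_single c]
    · simp
    · intro d _ hd
      rw [Polynomial.coeff_monomial, if_neg fun h => hd (ZMod.val_injective k h)]
    · simp
  rw [← hc, hP, Polynomial.coeff_zero]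

/-! ### The `ZMod k`-grading and invariant polynomials. -/

section Invariants

variable {k : ℕ} {w : σ → ℕ}

/-- A monomial is multiplied by `ε` to the power of its integral weight, and only the residue of
that weight modulo `k` matters. -/
theorem MvPolynomial.IsWeightedHomogeneous.eval_weightedScale {p : MvPolynomial σ ℂ} {c : ZMod k}
    (hp : IsWeightedHomogeneous (weightMod k w) p c) {ε : ℂ} (hε : ε ^ k = 1) (x : affineSpace σ) :
    evalAt (weightedScale w ε x) p = ε ^ c.val * evalAt x p := by
  induction hp using IsWeightedHomogeneous.induction_on with
  | zero => simp
  | add p q _ _ hp hq => rw [map_add, hp, hq, map_add, mul_add]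
  | monomial d r hr =>
    have : c = ((d.sum fun i e => e * w i : ℕ) : ZMod k) := by
      rw [← hr, Finsupp.weight_apply]
      simp [Finsupp.sum]
    rw [this, ← pow_eq_pow_val hε]
    rw [evalAt_monomial, evalAt_monomial]
    simp only [evalAt_weightedScale_X, mul_pow, ← pow_mul, Finsupp.prod, Finsupp.sum,
      Finset.prod_pow_eq_pow_sum, mul_comm (w _), Finset.prod_mul_distrib]
    ring

theorem IsCyclicInvariant.eval_weightedScale {p : MvPolynomial σ ℂ} (hp : IsCyclicInvariant k w p)
    {ε : ℂ} (hε : ε ^ k = 1) (x : affineSpace σ) : evalAt (weightedScale w ε x) p = evalAt x p := by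
  simpa using IsWeightedHomogeneous.eval_weightedScale hp hε x

theorem IsCyclicInvariant.pow_self {p : MvPolynomial σ ℂ} {c : ZMod k}
    (hp : IsWeightedHomogeneous (weightMod k w) p c) : IsCyclicInvariant k w (p ^ k) := by
  have := hp.pow k
  rwa [nsmul_eq_mul, CharP.cast_eq_zero, zero_mul] at this

variable [NeZero k]

theorem sum_component (p : MvPolynomial σ ℂ) :
    ∑ c : ZMod k, weightedHomogeneousComponent (weightMod k w) c p = p := by
  rw [← finsum_eq_sum_of_fintype, finsum_weightedHomogeneousComponent]

theorem eval_weightedScale_eq_sum (p : MvPolynomial σ ℂ) {ε : ℂ} (hε : ε ^ k = 1)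
    (x : affineSpace σ) :
    evalAt (weightedScale w ε x) p =
      ∑ c : ZMod k, ε ^ c.val * evalAt x (weightedHomogeneousComponent (weightMod k w) c p) := by
  conv_lhs => rw [← sum_component (k := k) (w := w) p, map_sum]
  exact Finset.sum_congr rfl fun c _ =>
    (weightedHomogeneousComponent_isWeightedHomogeneous c p).eval_weightedScale hε x

theorem exists_component_eval_ne_zero {p : MvPolynomial σ ℂ} {x : affineSpace σ}
    (hp : evalAt x p ≠ 0) :
    ∃ c : ZMod k, evalAt x (weightedHomogeneousComponent (weightMod k w) c p) ≠ 0 := by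
  by_contra! h
  rw [← sum_component (k := k) (w := w) p, map_sum] at hp
  exact hp (Finset.sum_eq_zero fun c _ => h c)

/-- Invariant open sets have a basis of nonvanishing loci of invariant polynomials. -/
theorem exists_isCyclicInvariant_of_isOpen {W : Set (affineSpace σ)} (hW : IsOpen W)
    (hinv : ∀ ε : ℂ, ε ^ k = 1 → ∀ x ∈ W, weightedScale w ε x ∈ W) {x : affineSpace σ}
    (hx : x ∈ W) : ∃ h : MvPolynomial σ ℂ, IsCyclicInvariant k w h ∧ evalAt x h ≠ 0 ∧
      ∀ y : affineSpace σ, evalAt y h ≠ 0 → y ∈ W := by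
  obtain ⟨p, hp, hpW⟩ := affineSpace_isOpen_iff.1 hW x hx
  obtain ⟨c, hc⟩ := exists_component_eval_ne_zero (k := k) (w := w) hp
  refine ⟨weightedHomogeneousComponent (weightMod k w) c p ^ k, .pow_self
    (weightedHomogeneousComponent_isWeightedHomogeneous c p), ?_, fun y hy => ?_⟩
  · rw [map_pow]
    exact pow_ne_zero _ hc
  -- If `y ∉ W`, then by invariance no translate of `y` lies in `W`, so `p` vanishes on the whole
  -- orbit of `y` and hence every component vanishes at `y`.
  · by_contra hyW
    rw [map_pow] at hy
    refine ne_zero_pow (NeZero.ne k) hy (eq_zero_of_sum_pow_val_mul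
      (fun c => evalAt y (weightedHomogeneousComponent (weightMod k w) c p)) (fun ε hε => ?_) c)
    rw [← eval_weightedScale_eq_sum p hε]
    by_contra hne
    refine hyW ?_
    have := hinv ε⁻¹ (by rw [inv_pow, hε, inv_one]) _ (hpW _ hne)
    rwa [weightedScale_inv_cancel w (ne_zero_of_pow_eq_one hε)] at this

/-- An invariant regular function is locally a fraction of invariant polynomials. -/
theorem exists_isCyclicInvariant_fraction {U : Opens (affineSpace σ)} {f : U → ℂ}
    (hf : f ∈ (affineSpace σ).regular U)
    (hU : ∀ ε : ℂ, ε ^ k = 1 → ∀ x ∈ U, weightedScale w ε x ∈ U)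
    (hinv : ∀ (ε : ℂ) (hε : ε ^ k = 1) (x : affineSpace σ) (hx : x ∈ U),
      f ⟨weightedScale w ε x, hU ε hε x hx⟩ = f ⟨x, hx⟩) (x : U) :
    ∃ p q : MvPolynomial σ ℂ, IsCyclicInvariant k w p ∧ IsCyclicInvariant k w q ∧
      evalAt (x : affineSpace σ) q ≠ 0 ∧
      ∀ y : U, f y * evalAt (y : affineSpace σ) q = evalAt (y : affineSpace σ) p := by
  obtain ⟨p, q, hq, e⟩ := mem_affineSpace_regular_iff.1 hf x
  obtain ⟨c, hc⟩ := exists_component_eval_ne_zero (k := k) (w := w) hq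
  set P := weightedHomogeneousComponent (weightMod k w) c p
  set Q := weightedHomogeneousComponent (weightMod k w) c q
  have hP := weightedHomogeneousComponent_isWeightedHomogeneous (w := weightMod k w) c p
  have hQ := weightedHomogeneousComponent_isWeightedHomogeneous (w := weightMod k w) c q
  -- Evaluating `f * q = p` along the orbit of `y`, where `f` is constant, splits the identity into
  -- its homogeneous components.
  have key : ∀ y : U, f y * evalAt (y : affineSpace σ) Q = evalAt (y : affineSpace σ) P := by
    intro y
    refine sub_eq_zero.1 (eq_zero_of_sum_pow_val_mul (k := k)
      (fun c => f y * evalAt (y : affineSpace σ) (weightedHomogeneousComponent (weightMod k w) c q) -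
        evalAt (y : affineSpace σ) (weightedHomogeneousComponent (weightMod k w) c p))
      (fun ε hε => ?_) c)
    have := e ⟨_, hU ε hε y y.2⟩
    rw [hinv ε hε y y.2] at this
    change f y * evalAt (weightedScale w ε y.1) q = evalAt (weightedScale w ε y.1) p at this
    rw [eval_weightedScale_eq_sum p hε, eval_weightedScale_eq_sum q hε, Finset.mul_sum,
      ← sub_eq_zero, ← Finset.sum_sub_distrib] at this
    rw [← this]
    exact Finset.sum_congr rfl fun c _ => by ring
  have hk : k - 1 + 1 = k := Nat.sub_add_cancel NeZero.one_le
  -- `P` and `Q` have the same degree `c`; the factor `Q ^ (k - 1)` brings both to degree `k * c =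
  -- 0`.
  refine ⟨P * Q ^ (k - 1), Q ^ k, ?_, .pow_self hQ, ?_, fun y => ?_⟩
  · have := hP.mul (hQ.pow (k - 1))
    rwa [← succ_nsmul', hk, nsmul_eq_mul, CharP.cast_eq_zero, zero_mul] at this
  · rw [map_pow]
    exact pow_ne_zero _ hc
  · rw [map_mul, ← key y]
    conv_lhs => rw [← hk, pow_succ', map_mul]
    ring

theorem isClosed_singleton_affineSpace (x : affineSpace σ) : IsClosed {x} := by
  refine isOpen_compl_iff.1 (affineSpace_isOpen_iff.2 fun y hy => ?_)
  obtain ⟨i, hi⟩ : ∃ i, (y : σ → ℂ) i ≠ (x : σ → ℂ) i := Function.ne_iff.1 hy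
  refine ⟨X i - C ((x : σ → ℂ) i), ?_, ?_⟩
  · rw [map_sub, evalAt_X, evalAt_C]
    exact sub_ne_zero.2 hi
  · rintro z hz rfl
    refine hz ?_
    rw [map_sub, evalAt_X, evalAt_C, sub_self]

/-- Invariant polynomials separate orbits. -/
theorem exists_eq_weightedScale {x y : affineSpace σ}
    (h : ∀ p, IsCyclicInvariant k w p → evalAt x p = evalAt y p) :
    ∃ ε : ℂ, ε ^ k = 1 ∧ x = weightedScale w ε y := by
  by_contra hxy
  -- The orbit of `y` is finite, hence closed; its complement is an invariant open set containing
  -- `x`, so some invariant is nonzero at `x` and zero on the orbit.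
  let O : Set (affineSpace σ) :=
    (fun ε => weightedScale w ε y) '' (Polynomial.nthRootsFinset k (1 : ℂ) : Set ℂ)
  have hO : IsClosed O := by
    have hfin : O.Finite := (Finset.finite_toSet _).image _
    rw [← Set.biUnion_of_singleton O]
    exact hfin.isClosed_biUnion fun z _ => isClosed_singleton_affineSpace z
  have hmem : ∀ {z : affineSpace σ}, z ∈ O ↔ ∃ ε : ℂ, ε ^ k = 1 ∧ z = weightedScale w ε y := by
    intro z
    exact exists_congr fun ε => and_congr (Polynomial.mem_nthRootsFinset (NeZero.pos k) 1) eq_comm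
  obtain ⟨p, hp, hpx, hpO⟩ := exists_isCyclicInvariant_of_isOpen (k := k) (w := w)
    hO.isOpen_compl (fun ε hε z hz hz' => hz <| by
      obtain ⟨δ, hδ, e⟩ := hmem.1 hz'
      refine hmem.2 ⟨ε⁻¹ * δ, by rw [mul_pow, inv_pow, hε, hδ, inv_one, one_mul], ?_⟩
      rw [weightedScale_mul, ← e, weightedScale_inv_cancel w (ne_zero_of_pow_eq_one hε)])
    (show x ∈ Oᶜ from fun hx => hxy (hmem.1 hx))
  refine hpO y (by rwa [← h p hp]) (hmem.2 ⟨1, one_pow k, (weightedScale_one w y).symm⟩)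

/-- A surjective morphism which is constant on orbits is a quotient morphism if each invariant
polynomial is the pullback of a regular function. -/
theorem isQuotientMorphism_of_isCyclicInvariant {Y : SpaceWithFunctions} (hY : Y.IsLocallyRinged)
    {φ : affineSpace σ → Y} (hφ : IsMorphism φ) (hsurj : Function.Surjective φ)
    (hinv : ∀ ε : ℂ, ε ^ k = 1 → ∀ x, φ (weightedScale w ε x) = φ x)
    (hlift : ∀ p, IsCyclicInvariant k w p → ∃ r ∈ Y.regular ⊤, ∀ x : affineSpace σ,
      r ⟨φ x, trivial⟩ = evalAt x p) : IsQuotientMorphism φ where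
  toIsMorphism := hφ
  surjective := hsurj
  isOpen_of_preimage T hT := by
    refine isOpen_iff_mem_nhds.2 fun y hy => ?_
    obtain ⟨x, rfl⟩ := hsurj y
    obtain ⟨h, hh, hx, hT'⟩ := exists_isCyclicInvariant_of_isOpen (k := k) (w := w) hT
      (fun ε hε z hz => by rwa [Set.mem_preimage, hinv ε hε]) hy
    obtain ⟨r, hr, e⟩ := hlift h hh
    refine Filter.mem_of_superset ((hY.isOpen_ne_zero ⊤ r hr).mem_nhds ⟨trivial, by rwa [e]⟩) ?_
    rintro y ⟨_, hy⟩
    obtain ⟨x', rfl⟩ := hsurj y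
    exact hT' x' (by rwa [← e])
  mem_of_comp_mem V f hf := by
    refine Y.mem_of_locally _ _ fun ⟨y, hy⟩ => ?_
    obtain ⟨x, rfl⟩ := hsurj y
    obtain ⟨p, q, hp, hq, hqx, e⟩ := exists_isCyclicInvariant_fraction (k := k) (w := w) hf
      (fun ε hε z hz => by
        change φ (weightedScale w ε z) ∈ V
        rwa [hinv ε hε])
      (fun ε hε z hz => by simp only [hinv ε hε]) ⟨x, hy⟩
    obtain ⟨r, hr, hrp⟩ := hlift p hp
    obtain ⟨s, hs, hsq⟩ := hlift q hq
    -- The fraction `p / q` descends to `r * s⁻¹` on the locus where `s` is invertible.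
    let D : Opens Y := ⟨_, hY.isOpen_ne_zero ⊤ s hs⟩
    have hs' := hY.inv_mem D _ (restrict_mem_regular hs le_top) fun y => y.2.2
    refine ⟨D, ⟨trivial, by rwa [hsq]⟩, _, mul_mem (restrict_mem_regular hr le_top) hs',
      fun ⟨y, hyV⟩ hyD => ?_⟩
    obtain ⟨x', rfl⟩ := hsurj y
    have hne : evalAt x' q ≠ 0 := by
      rw [← hsq]
      exact hyD.2
    refine (eq_div_of_mul_eq hne (e ⟨x', hyV⟩)).trans ?_
    change _ = r ⟨φ x', trivial⟩ * (s ⟨φ x', trivial⟩)⁻¹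
    rw [hrp, hsq, div_eq_mul_inv]

end Invariants

/-! ### The invariant ring and the affine model of the cyclic quotient. -/

section AffineModel

variable {k : ℕ} {w : σ → ℕ}

/-- The projection onto the invariant polynomials is linear over the invariant polynomials. -/
theorem component_zero_mul [NeZero k] {g : MvPolynomial σ ℂ} (hg : IsCyclicInvariant k w g)
    (c : MvPolynomial σ ℂ) :
    weightedHomogeneousComponent (weightMod k w) 0 (c * g) =
      weightedHomogeneousComponent (weightMod k w) 0 c * g := by
  have h : ∀ d : ZMod k, weightedHomogeneousComponent (weightMod k w) 0
      (weightedHomogeneousComponent (weightMod k w) d c * g) =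
        if d = 0 then weightedHomogeneousComponent (weightMod k w) d c * g else 0 := by
    intro d
    have hd := (weightedHomogeneousComponent_isWeightedHomogeneous
      (w := weightMod k w) d c).mul hg
    rw [add_zero] at hd
    rw [weightedHomogeneousComponent_of_mem ((mem_weightedHomogeneousSubmodule ..).2 hd)]
    simp only [eq_comm]
  conv_lhs => rw [← sum_component (k := k) (w := w) c, Finset.sum_mul, map_sum]
  rw [Finset.sum_congr rfl fun d _ => h d, Finset.sum_ite_eq' Finset.univ 0,
    if_pos (Finset.mem_univ _)]

theorem weight_weightMod_eq {d e : σ →₀ ℕ} (f : σ →₀ ℕ) (h : d = k • f + e) :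
    Finsupp.weight (weightMod k w) d = Finsupp.weight (weightMod k w) e := by
  rw [h, map_add, map_nsmul, nsmul_eq_mul, CharP.cast_eq_zero, zero_mul, zero_add]

/-- The algebra of invariant polynomials is generated by finitely many monomials. -/
theorem exists_isCyclicInvariant_generators [Finite σ] (k : ℕ) [NeZero k] (w : σ → ℕ) :
    ∃ (M : ℕ) (g : Fin M → MvPolynomial σ ℂ), (∀ i, IsCyclicInvariant k w (g i)) ∧
      ∀ p, IsCyclicInvariant k w p → ∃ P : MvPolynomial (Fin M) ℂ, aeval g P = p := by
  classical
  have := Fintype.ofFinite σ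
  -- The bound `k` on exponents is inclusive: the generators must contain the pure powers `x_i ^ k`
  -- as well as the invariant monomials with all exponents below `k`.
  let K : σ →₀ ℕ := Finsupp.equivFunOnFinite.symm fun _ => k
  let S : Set (MvPolynomial σ ℂ) := (fun d => monomial d 1) ''
    {d : σ →₀ ℕ | d ≤ K ∧ Finsupp.weight (weightMod k w) d = 0}
  have hS : S.Finite := ((Set.finite_Icc 0 K).subset fun d hd => ⟨zero_le, hd.1⟩).image _
  obtain ⟨M, g, -, hg⟩ := hS.fin_param
  refine ⟨M, g, fun i => ?_, fun p hp => ?_⟩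
  · obtain ⟨d, hd, e⟩ : g i ∈ S := hg ▸ Set.mem_range_self i
    rw [← e]
    exact isWeightedHomogeneous_monomial _ _ _ hd.2
  have hmem : ∀ d : σ →₀ ℕ, d ≤ K → Finsupp.weight (weightMod k w) d = 0 →
      monomial d (1 : ℂ) ∈ (aeval g : MvPolynomial (Fin M) ℂ →ₐ[ℂ] _).range := by
    intro d hd hd'
    rw [← Algebra.adjoin_range_eq_range_aeval, hg]
    exact Algebra.subset_adjoin ⟨d, ⟨hd, hd'⟩, rfl⟩
  change p ∈ (aeval g : MvPolynomial (Fin M) ℂ →ₐ[ℂ] _).range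
  induction hp using IsWeightedHomogeneous.induction_on with
  | zero => exact zero_mem _
  | add p q _ _ hp hq => exact add_mem hp hq
  | monomial d r hr =>
    -- Division with remainder by `k` in each exponent: the quotient part is a product of powers
    -- `x_i ^ k`, and the remainder has the same weight modulo `k`.
    let f : σ →₀ ℕ := Finsupp.equivFunOnFinite.symm fun i => d i / k
    let e : σ →₀ ℕ := Finsupp.equivFunOnFinite.symm fun i => d i % k
    have hd : d = k • f + e := by
      ext i
      exact (Nat.div_add_mod (d i) k).symm
    have hf : monomial (k • f) (1 : ℂ) = ∏ i, monomial (Finsupp.single i k) (1 : ℂ) ^ f i := by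
      rw [monomial_eq, Finsupp.prod_fintype _ _ fun _ => pow_zero _, C_1, one_mul]
      refine Finset.prod_congr rfl fun i _ => ?_
      rw [← X_pow_eq_monomial, ← pow_mul]
      rfl
    have hdr : monomial d r = r • (monomial (k • f) (1 : ℂ) * monomial e (1 : ℂ)) := by
      rw [monomial_mul, ← hd, smul_monomial, smul_eq_mul, mul_one, mul_one]
    rw [hdr, hf]
    refine Subalgebra.smul_mem _ (mul_mem (prod_mem fun i _ => pow_mem (hmem _ ?_ ?_) _)
      (hmem e (fun i => (Nat.mod_lt _ (NeZero.pos k)).le) ?_)) _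
    · intro j
      rw [Finsupp.single_apply]
      split_ifs
      · exact le_rfl
      · exact Nat.zero_le _
    · rw [Finsupp.weight_single, nsmul_eq_mul, CharP.cast_eq_zero, zero_mul]
    · rw [← hr, weight_weightMod_eq f hd]

/-- The quotient of affine space by a diagonal action of a finite cyclic group is a closed
algebraic subset of an affine space. -/
theorem exists_affine_quotientMorphism [Finite σ] (k : ℕ) [NeZero k] (w : σ → ℕ) :
    ∃ (M : ℕ) (I : Ideal (MvPolynomial (Fin M) ℂ)) (φ : affineSpace σ →
      (affineSpace (Fin M)).induced {x : Fin M → ℂ | ∀ p ∈ I, MvPolynomial.eval x p = 0}),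
      IsQuotientMorphism φ ∧
        ∀ x y, φ x = φ y ↔ ∃ ε : ℂ, ε ^ k = 1 ∧ x = weightedScale w ε y := by
  obtain ⟨M, g, hg, hgen⟩ := exists_isCyclicInvariant_generators k w
  let I : Ideal (MvPolynomial (Fin M) ℂ) := RingHom.ker (aeval g : _ →ₐ[ℂ] MvPolynomial σ ℂ)
  have hmem : ∀ x, polynomialMap g x ∈
      ({x | ∀ p ∈ I, evalAt x p = 0} : Set (affineSpace (Fin M))) := by
    intro x p hp
    rw [evalAt_polynomialMap, (RingHom.mem_ker).1 hp, map_zero]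
  let φ : affineSpace σ → (affineSpace (Fin M)).induced
    {x : Fin M → ℂ | ∀ p ∈ I, MvPolynomial.eval x p = 0} := fun x => ⟨polynomialMap g x, hmem x⟩
  have hmor : IsMorphism φ := (isMorphism_polynomialMap g).codRestrict hmem
  have hφ : ∀ x P, evalAt (φ x).1 P = evalAt x (aeval g P) := evalAt_polynomialMap g
  have hinv : ∀ ε : ℂ, ε ^ k = 1 → ∀ x, φ (weightedScale w ε x) = φ x := fun ε hε x =>
    Subtype.ext (funext fun i => (hg i).eval_weightedScale hε x)
  have hsurj : Function.Surjective φ := by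
    rintro ⟨z, hz⟩
    -- `J` defines the fibre over `z`, so a point exists once `J` is proper.
    let J : Ideal (MvPolynomial σ ℂ) :=
      Ideal.span (Set.range fun i => g i - C ((z : Fin M → ℂ) i))
    have hJ : J ≠ ⊤ := by
      intro hJ
      have h1 : (1 : MvPolynomial σ ℂ) ∈ J := hJ ▸ Submodule.mem_top
      obtain ⟨c, hc⟩ := Ideal.mem_span_range_iff_exists_fun.1 h1
      -- Projecting `1 = ∑ c_i (g_i - z_i)` to degree `0` makes the coefficients invariant, hence
      -- polynomials `P_i` in the `g_i`. Then `∑ P_i (X_i - z_i) - 1` is a relation among the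
      -- generators, yet its value at `z` is `-1`.
      have hc' := congrArg (weightedHomogeneousComponent (weightMod k w) 0) hc
      rw [map_sum, (isWeightedHomogeneous_one ℂ (weightMod k w)).weightedHomogeneousComponent_same]
        at hc'
      choose P hP using fun i => hgen _
        (weightedHomogeneousComponent_isWeightedHomogeneous (w := weightMod k w) 0 (c i))
      have hQ : ∑ i, P i * (X i - C ((z : Fin M → ℂ) i)) - 1 ∈ I := by
        refine RingHom.mem_ker.2 ?_
        rw [map_sub, map_sum, map_one, sub_eq_zero, ← hc']
        refine Finset.sum_congr rfl fun i _ => ?_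
        rw [component_zero_mul ((hg i).sub (isWeightedHomogeneous_C _ _)), map_mul, map_sub,
          aeval_X, hP, algHom_C, algebraMap_eq]
      have : evalAt z _ = 0 := hz _ hQ
      rw [map_sub, map_sum, map_one, Finset.sum_eq_zero fun i _ => by
        rw [map_mul, map_sub, evalAt_X, evalAt_C, sub_self, mul_zero]] at this
      norm_num at this
    obtain ⟨m, hm, hJm⟩ := Ideal.exists_le_maximal J hJ
    -- Nullstellensatz: a maximal ideal above `J` is the ideal of a point, which then lies in the
    -- fibre.
    obtain ⟨x, rfl⟩ := isMaximal_iff_eq_vanishingIdeal_singleton.1 hm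
    refine ⟨x, Subtype.ext (funext fun i => ?_)⟩
    have := (mem_vanishingIdeal_singleton_iff ..).1 (hJm (Ideal.subset_span ⟨i, rfl⟩))
    rw [map_sub, sub_eq_zero, aeval_C] at this
    exact this
  refine ⟨M, I, φ, isQuotientMorphism_of_isCyclicInvariant (k := k) (w := w)
      ((affineSpace_isLocallyRinged _).induced _) hmor hsurj hinv fun p hp => ?_,
      fun x y => ⟨fun h => ?_, ?_⟩⟩
  · obtain ⟨P, rfl⟩ := hgen p hp
    exact ⟨_, (isMorphism_subtype_val _).comp_mem ⊤ _ (evalAt_mem_affineSpace_regular P ⊤),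
      fun x => hφ x P⟩
  · refine exists_eq_weightedScale fun p hp => ?_
    obtain ⟨P, rfl⟩ := hgen p hp
    rw [← hφ, ← hφ, h]
  · rintro ⟨ε, hε, rfl⟩
    exact hinv ε hε y

end AffineModel

/-! ### Torus orbits and the open cover of the weighted bundle. -/

namespace WeightedBundle

variable {n m : ℕ} (F : WeightedBundle n m)

theorem mem_nonvanishingLocus_iff {z : affineSpace (Fin (n + 1) ⊕ Fin (m + 1))} :
    z ∈ nonvanishingLocus F.irrelevantIdeal ↔
      ∃ i j, evalAt z (X (Sum.inl i)) * evalAt z (X (Sum.inr j)) ≠ 0 := by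
  constructor
  · rintro ⟨p, ⟨hp₁, hp₂⟩, hp⟩
    change evalAt z p ≠ 0 at hp
    by_contra! h
    by_cases hx : ∃ i, evalAt z (X (Sum.inl i)) ≠ 0
    · obtain ⟨i, hi⟩ := hx
      refine hp ((Ideal.span_le (I := RingHom.ker (evalAt z))).2 ?_ hp₂)
      rintro _ ⟨j, rfl⟩
      exact (mul_eq_zero.1 (h i j)).resolve_left hi
    · push Not at hx
      refine hp ((Ideal.span_le (I := RingHom.ker (evalAt z))).2 ?_ hp₁)
      rintro _ ⟨i, rfl⟩
      exact hx i
  · rintro ⟨i, j, h⟩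
    refine ⟨X (Sum.inl i) * X (Sum.inr j), ⟨Ideal.mul_mem_right _ _ (Ideal.subset_span ⟨i, rfl⟩),
      Ideal.mul_mem_left _ _ (Ideal.subset_span ⟨j, rfl⟩)⟩, ?_⟩
    change evalAt z _ ≠ 0
    rwa [map_mul]

/-- Two points in the same torus orbit; the denominators in the action are cleared. -/
def SameOrbit (z z' : affineSpace (Fin (n + 1) ⊕ Fin (m + 1))) : Prop :=
  ∃ s t : ℂ, s ≠ 0 ∧ t ≠ 0 ∧
    (∀ i, evalAt z (X (Sum.inl i)) = s * evalAt z' (X (Sum.inl i))) ∧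
    ∀ j, s ^ F.ω j * evalAt z (X (Sum.inr j)) = t ^ F.a j * evalAt z' (X (Sum.inr j))

theorem pointClass_eq_iff {z z' : (affineSpace (Fin (n + 1) ⊕ Fin (m + 1))).induced
    (nonvanishingLocus F.irrelevantIdeal)} :
    F.pointClass z = F.pointClass z' ↔ F.SameOrbit z.1 z'.1 := by
  have hl : ∀ (t : Fin 2 → ℂˣ) (i : Fin (n + 1)),
      torusCharacter (fun l => F.matrix l (Sum.inl i)) t = t 0 := by
    intro t i
    simp [torusCharacter, matrix]
  have hr : ∀ (t : Fin 2 → ℂˣ) (j : Fin (m + 1)),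
      torusCharacter (fun l => F.matrix l (Sum.inr j)) t = (t 0 ^ F.ω j)⁻¹ * t 1 ^ F.a j := by
    intro t j
    simp [torusCharacter, matrix]
  refine Quotient.eq.trans ?_
  constructor
  · rintro ⟨t, ht⟩
    have ht' : ∀ l, (torusCharacter (fun i => F.matrix i l) t : ℂ) * evalAt z'.1 (X l) =
        evalAt z.1 (X l) := by
      intro l
      rw [evalAt_X, evalAt_X]
      exact congrFun ht l
    refine ⟨t 0, t 1, (t 0).ne_zero, (t 1).ne_zero, fun i => ?_, fun j => ?_⟩
    · rw [← ht', hl]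
    · rw [← ht', hr, Units.val_mul, Units.val_inv_eq_inv_val, Units.val_pow_eq_pow_val,
        Units.val_pow_eq_pow_val, ← mul_assoc,
        mul_inv_cancel_left₀ (pow_ne_zero _ (t 0).ne_zero)]
  · rintro ⟨s, t, hs, ht, hx, hy⟩
    let u : Fin 2 → ℂˣ := ![Units.mk0 s hs, Units.mk0 t ht]
    suffices h : ∀ l, (torusCharacter (fun i => F.matrix i l) u : ℂ) * evalAt z'.1 (X l) =
        evalAt z.1 (X l) by
      refine ⟨u, funext fun l => ?_⟩
      have := h l
      rw [evalAt_X, evalAt_X] at this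
      exact this
    intro l
    cases l with
    | inl i =>
      rw [hl, hx]
      rfl
    | inr j =>
      rw [hr, Units.val_mul, Units.val_inv_eq_inv_val, Units.val_pow_eq_pow_val,
        Units.val_pow_eq_pow_val, mul_assoc]
      change (s ^ F.ω j)⁻¹ * (t ^ F.a j * _) = _
      rw [← hy, inv_mul_cancel_left₀ (pow_ne_zero _ hs)]

theorem SameOrbit.mul_ne_zero {F : WeightedBundle n m}
    {z z' : affineSpace (Fin (n + 1) ⊕ Fin (m + 1))} (h : F.SameOrbit z z') {i : Fin (n + 1)}
    {j : Fin (m + 1)} (hz : evalAt z' (X (Sum.inl i)) * evalAt z' (X (Sum.inr j)) ≠ 0) :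
    evalAt z (X (Sum.inl i)) * evalAt z (X (Sum.inr j)) ≠ 0 := by
  obtain ⟨s, t, hs, ht, hx, hy⟩ := h
  refine _root_.mul_ne_zero ?_ ?_
  · rw [hx]
    exact _root_.mul_ne_zero hs (left_ne_zero_of_mul hz)
  · refine right_ne_zero_of_mul (a := s ^ F.ω j) ?_
    rw [hy]
    exact _root_.mul_ne_zero (pow_ne_zero _ ht) (right_ne_zero_of_mul hz)

theorem pointClass_mem_patch_iff {z : (affineSpace (Fin (n + 1) ⊕ Fin (m + 1))).induced
    (nonvanishingLocus F.irrelevantIdeal)} {i : Fin (n + 1)} {j : Fin (m + 1)} :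
    F.pointClass z ∈ F.patch i j ↔
      evalAt z.1 (X (Sum.inl i)) * evalAt z.1 (X (Sum.inr j)) ≠ 0 := by
  rw [evalAt_X, evalAt_X]
  constructor
  · rintro ⟨z', hz', h⟩
    have h' := F.pointClass_eq_iff.1 h.symm
    have := h'.mul_ne_zero (i := i) (j := j)
    rw [evalAt_X, evalAt_X, evalAt_X, evalAt_X] at this
    exact this hz'
  · exact fun hz => ⟨z, hz, rfl⟩

theorem pointClass_surjective : Function.Surjective F.pointClass :=
  Quotient.mk_surjective

theorem iUnion_patch :
    (⋃ ij : Fin (n + 1) × Fin (m + 1), F.patch ij.1 ij.2) = Set.univ := by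
  refine Set.eq_univ_of_forall fun y => ?_
  obtain ⟨z, rfl⟩ := F.pointClass_surjective y
  obtain ⟨i, j, h⟩ := F.mem_nonvanishingLocus_iff.1 z.2
  exact Set.mem_iUnion.2 ⟨(i, j), F.pointClass_mem_patch_iff.2 h⟩

theorem isOpen_patch (i : Fin (n + 1)) (j : Fin (m + 1)) : IsOpen (F.patch i j) := by
  have h := (isOpen_evalAt_ne_zero
    (X (Sum.inl i) * X (Sum.inr j) : MvPolynomial (Fin (n + 1) ⊕ Fin (m + 1)) ℂ)).preimage
    (continuous_subtype_val (p := (· ∈ nonvanishingLocus F.irrelevantIdeal)))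
  refine (isQuotientMorphism_mk _).isOpen_of_preimage _ ((congrArg IsOpen ?_).mpr h)
  refine Set.ext fun z => F.pointClass_mem_patch_iff.trans ?_
  rw [← map_mul]
  rfl

/-- The point whose only nonzero coordinates are `x_i = y_j = 1` lies in the patch `U_{ij}` and in
no other. -/
theorem patch_injective :
    Function.Injective (fun ij : Fin (n + 1) × Fin (m + 1) => F.patch ij.1 ij.2) := by
  rintro ⟨i, j⟩ ⟨i', j'⟩ h
  obtain ⟨z, hx, hy⟩ : ∃ z : affineSpace (Fin (n + 1) ⊕ Fin (m + 1)),
      (∀ l, evalAt z (X (Sum.inl l)) = (Pi.single i 1 : Fin (n + 1) → ℂ) l) ∧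
      ∀ l, evalAt z (X (Sum.inr l)) = (Pi.single j 1 : Fin (m + 1) → ℂ) l :=
    ⟨Sum.elim (Pi.single i 1) (Pi.single j 1), fun l => evalAt_X _ _, fun l => evalAt_X _ _⟩
  have hz : evalAt z (X (Sum.inl i)) * evalAt z (X (Sum.inr j)) ≠ 0 := by
    simp [hx, hy]
  have h₁ : F.pointClass ⟨z, F.mem_nonvanishingLocus_iff.2 ⟨i, j, hz⟩⟩ ∈ F.patch i j :=
    F.pointClass_mem_patch_iff.2 hz
  have h₂ : F.patch i j = F.patch i' j' := h
  rw [h₂] at h₁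
  have h₃ : evalAt z (X (Sum.inl i')) * evalAt z (X (Sum.inr j')) ≠ 0 :=
    (F.pointClass_mem_patch_iff (z := ⟨z, F.mem_nonvanishingLocus_iff.2 ⟨i, j, hz⟩⟩)).1 h₁
  rw [hx, hy] at h₃
  refine Prod.ext ?_ ?_
  · by_contra hne
    exact left_ne_zero_of_mul h₃ (Pi.single_eq_of_ne (Ne.symm hne) _)
  · by_contra hne
    exact right_ne_zero_of_mul h₃ (Pi.single_eq_of_ne (Ne.symm hne) _)

/-! ### The slice and the quotient structure of a single patch. -/

section Patch

variable (i : Fin (n + 1)) (j : Fin (m + 1))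

/-- The weights of the cyclic group on the patch `U_{ij}`. -/
abbrev patchWeight : Fin (n + m) → ℕ :=
  Fin.append (fun _ : Fin n => 0) (fun k : Fin m => F.a (j.succAbove k))

/-- The components of the parametrization of `U_{ij}` by points with `x_i = y_j = 1`. -/
def slicePolynomial : Fin (n + 1) ⊕ Fin (m + 1) → MvPolynomial (Fin (n + m)) ℂ :=
  Sum.elim (i.insertNth (α := fun _ => MvPolynomial (Fin (n + m)) ℂ) 1
      fun l => X (Fin.castAdd m l))
    (j.insertNth (α := fun _ => MvPolynomial (Fin (n + m)) ℂ) 1 fun l => X (Fin.natAdd n l))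

/-- The point of `ℂ^{n+m+2}` with `x_i = y_j = 1` and the given remaining coordinates. -/
def slice : affineSpace (Fin (n + m)) → affineSpace (Fin (n + 1) ⊕ Fin (m + 1)) :=
  polynomialMap (slicePolynomial i j)

variable (x : affineSpace (Fin (n + m)))

theorem evalAt_slice_X (l : Fin (n + 1) ⊕ Fin (m + 1)) :
    evalAt (slice i j x) (X l) = evalAt x (slicePolynomial i j l) :=
  evalAt_X _ _

theorem evalAt_slice_inl : evalAt (slice i j x) (X (Sum.inl i)) = 1 := by
  rw [evalAt_slice_X, slicePolynomial, Sum.elim_inl, Fin.insertNth_apply_same, map_one]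

theorem evalAt_slice_inl_succAbove (l : Fin n) :
    evalAt (slice i j x) (X (Sum.inl (i.succAbove l))) = evalAt x (X (Fin.castAdd m l)) := by
  rw [evalAt_slice_X, slicePolynomial, Sum.elim_inl, Fin.insertNth_apply_succAbove]

theorem evalAt_slice_inr : evalAt (slice i j x) (X (Sum.inr j)) = 1 := by
  rw [evalAt_slice_X, slicePolynomial, Sum.elim_inr, Fin.insertNth_apply_same, map_one]

theorem evalAt_slice_inr_succAbove (l : Fin m) :
    evalAt (slice i j x) (X (Sum.inr (j.succAbove l))) = evalAt x (X (Fin.natAdd n l)) := by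
  rw [evalAt_slice_X, slicePolynomial, Sum.elim_inr, Fin.insertNth_apply_succAbove]

theorem slice_mul_ne_zero :
    evalAt (slice i j x) (X (Sum.inl i)) * evalAt (slice i j x) (X (Sum.inr j)) ≠ 0 := by
  rw [evalAt_slice_inl, evalAt_slice_inr, one_mul]
  exact one_ne_zero

theorem slice_mem : slice i j x ∈ nonvanishingLocus F.irrelevantIdeal :=
  F.mem_nonvanishingLocus_iff.2 ⟨i, j, slice_mul_ne_zero i j x⟩

/-- The parametrization of the patch `U_{ij}` by `ℂ^{n+m}`. -/
def patchMap : affineSpace (Fin (n + m)) → F.space.induced (F.patch i j) := fun x =>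
  ⟨F.pointClass ⟨slice i j x, F.slice_mem i j x⟩,
    F.pointClass_mem_patch_iff.2 (slice_mul_ne_zero i j x)⟩

theorem isMorphism_patchMap : IsMorphism (F.patchMap i j) :=
  IsMorphism.codRestrict (Y := F.space) (((isQuotientMorphism_mk _).toIsMorphism).comp
    ((isMorphism_polynomialMap (slicePolynomial i j)).codRestrict (F.slice_mem i j)))
    fun x => F.pointClass_mem_patch_iff.2 (slice_mul_ne_zero i j x)

theorem exists_sameOrbit_slice {z : affineSpace (Fin (n + 1) ⊕ Fin (m + 1))}
    (hz : evalAt z (X (Sum.inl i)) * evalAt z (X (Sum.inr j)) ≠ 0) :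
    ∃ x, F.SameOrbit z (slice i j x) := by
  set s := evalAt z (X (Sum.inl i))
  have hs0 : s ≠ 0 := left_ne_zero_of_mul hz
  -- This is the orbit equation for `y_j` when the slice coordinate is `1`; the other equations then
  -- determine `x`.
  obtain ⟨t, ht⟩ := IsAlgClosed.exists_pow_nat_eq (s ^ F.ω j * evalAt z (X (Sum.inr j)))
    (F.a_pos j)
  have ht0 : t ≠ 0 := by
    rintro rfl
    rw [zero_pow (F.a_pos j).ne'] at ht
    exact mul_ne_zero (pow_ne_zero _ hs0) (right_ne_zero_of_mul hz) ht.symm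
  let x : affineSpace (Fin (n + m)) := Fin.append
    (fun l => s⁻¹ * evalAt z (X (Sum.inl (i.succAbove l))))
    (fun l => (t ^ F.a (j.succAbove l))⁻¹ *
      (s ^ F.ω (j.succAbove l) * evalAt z (X (Sum.inr (j.succAbove l)))))
  have hx₁ : ∀ l, evalAt x (X (Fin.castAdd m l)) =
      s⁻¹ * evalAt z (X (Sum.inl (i.succAbove l))) := fun l =>
    (evalAt_X _ _).trans (Fin.append_left _ _ l)
  have hx₂ : ∀ l, evalAt x (X (Fin.natAdd n l)) = (t ^ F.a (j.succAbove l))⁻¹ *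
      (s ^ F.ω (j.succAbove l) * evalAt z (X (Sum.inr (j.succAbove l)))) := fun l =>
    (evalAt_X _ _).trans (Fin.append_right _ _ l)
  refine ⟨x, s, t, hs0, ht0, fun l => ?_, fun l => ?_⟩
  · rcases Fin.eq_self_or_eq_succAbove i l with rfl | ⟨l, rfl⟩
    · rw [evalAt_slice_inl, mul_one]
    · rw [evalAt_slice_inl_succAbove, hx₁, mul_inv_cancel_left₀ hs0]
  · rcases Fin.eq_self_or_eq_succAbove j l with rfl | ⟨l, rfl⟩
    · rw [evalAt_slice_inr, mul_one, ht]
    · rw [evalAt_slice_inr_succAbove, hx₂, mul_inv_cancel_left₀ (pow_ne_zero _ ht0)]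

theorem patchMap_surjective : Function.Surjective (F.patchMap i j) := by
  intro y
  obtain ⟨z, hz⟩ := F.pointClass_surjective y.1
  have hy : F.pointClass z ∈ F.patch i j := hz ▸ y.2
  obtain ⟨x, hx⟩ := F.exists_sameOrbit_slice i j (F.pointClass_mem_patch_iff.1 hy)
  have h : F.pointClass z = F.pointClass ⟨slice i j x, F.slice_mem i j x⟩ :=
    F.pointClass_eq_iff.2 hx
  exact ⟨x, Subtype.ext (h.symm.trans hz)⟩

theorem patchMap_weightedScale {ε : ℂ} (hε : ε ^ F.a j = 1) :
    F.patchMap i j (weightedScale (F.patchWeight j) ε x) = F.patchMap i j x := by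
  have : NeZero (F.a j) := ⟨(F.a_pos j).ne'⟩
  -- The torus element `(1, ε)` fixes `y_j = 1` because `ε ^ a_j = 1`.
  refine Subtype.ext (F.pointClass_eq_iff.2
    ⟨1, ε, one_ne_zero, ne_zero_of_pow_eq_one hε, fun l => ?_, fun l => ?_⟩)
  · rw [one_mul]
    rcases Fin.eq_self_or_eq_succAbove i l with rfl | ⟨l, rfl⟩
    · rw [evalAt_slice_inl, evalAt_slice_inl]
    · rw [evalAt_slice_inl_succAbove, evalAt_slice_inl_succAbove, evalAt_weightedScale_X,
        patchWeight, Fin.append_left, pow_zero, one_mul]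
  · rw [one_pow, one_mul]
    rcases Fin.eq_self_or_eq_succAbove j l with rfl | ⟨l, rfl⟩
    · rw [evalAt_slice_inr, evalAt_slice_inr, hε, one_mul]
    · rw [evalAt_slice_inr_succAbove, evalAt_slice_inr_succAbove, evalAt_weightedScale_X,
        patchWeight, Fin.append_right]

/-- An invariant polynomial on the slice extends to a fraction on `{x_i y_j ≠ 0}` which is
constant on torus orbits. -/
theorem exists_homogenization {p : MvPolynomial (Fin (n + m)) ℂ}
    (hp : IsCyclicInvariant (F.a j) (F.patchWeight j) p) :
    ∃ (H : MvPolynomial (Fin (n + 1) ⊕ Fin (m + 1)) ℂ) (P Q : ℕ), ∀ z x,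
      F.SameOrbit z (slice i j x) → evalAt z H =
        evalAt z (X (Sum.inl i)) ^ P * evalAt z (X (Sum.inr j)) ^ Q * evalAt x p := by
  induction hp using IsWeightedHomogeneous.induction_on with
  | zero => exact ⟨0, 0, 0, fun z x _ => by simp⟩
  | add p₁ p₂ _ _ h₁ h₂ =>
    obtain ⟨H₁, P₁, Q₁, h₁⟩ := h₁
    obtain ⟨H₂, P₂, Q₂, h₂⟩ := h₂
    refine ⟨X (Sum.inl i) ^ P₂ * X (Sum.inr j) ^ Q₂ * H₁ +
      X (Sum.inl i) ^ P₁ * X (Sum.inr j) ^ Q₁ * H₂, P₁ + P₂, Q₁ + Q₂, fun z x hzx => ?_⟩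
    simp only [map_add, map_mul, map_pow, h₁ z x hzx, h₂ z x hzx]
    ring
  | monomial d r hd =>
    -- The first `n` weights are zero, so invariance of the monomial constrains only its
    -- `y`-exponents.
    obtain ⟨c, hc⟩ : F.a j ∣ ∑ l, F.a (j.succAbove l) * d (Fin.natAdd n l) := by
      rw [← CharP.cast_eq_zero_iff (ZMod (F.a j)), ← hd, Finsupp.weight_eq_sum,
        Fin.sum_univ_add]
      simp [weightMod, mul_comm]
    -- With `z = (s, t) • slice x`, the factors become `s * x_l` and `t ^ a_l * y_l`, where `x_l`,
    -- `y_l` are slice coordinates. The total power of `t` is `t ^ (a_j * c)`, and `t ^ a_j` equals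
    -- `s ^ ω_j` times the `y_j`-coordinate of `z`; with `s = x_i` this gives both exponents.
    refine ⟨C r * (∏ l, X (Sum.inl (i.succAbove l)) ^ d (Fin.castAdd m l)) *
      ∏ l, (X (Sum.inl i) ^ F.ω (j.succAbove l) * X (Sum.inr (j.succAbove l))) ^
        d (Fin.natAdd n l), ∑ l, d (Fin.castAdd m l) + F.ω j * c, c, ?_⟩
    rintro z x ⟨s, t, hs, ht, hx, hy⟩
    have hs' : evalAt z (X (Sum.inl i)) = s := by rw [hx, evalAt_slice_inl, mul_one]
    have hj := hy j
    rw [evalAt_slice_inr, mul_one] at hj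
    rw [evalAt_monomial, Finsupp.prod_fintype _ _ fun _ => pow_zero _, Fin.prod_univ_add]
    simp only [map_mul, map_prod, map_pow, evalAt_C, hs', hy (j.succAbove _), hx (i.succAbove _),
      evalAt_slice_inl_succAbove, evalAt_slice_inr_succAbove]
    simp only [mul_pow, Finset.prod_mul_distrib, ← pow_mul, Finset.prod_pow_eq_pow_sum, hc, pow_add]
    rw [pow_mul t, ← hj, mul_pow, ← pow_mul]
    ring

theorem exists_regular_comp_patchMap {p : MvPolynomial (Fin (n + m)) ℂ}
    (hp : IsCyclicInvariant (F.a j) (F.patchWeight j) p) :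
    ∃ r ∈ (F.space.induced (F.patch i j)).regular ⊤, ∀ x,
      r ⟨F.patchMap i j x, trivial⟩ = evalAt x p := by
  obtain ⟨H, P, Q, hH⟩ := F.exists_homogenization i j hp
  have hsurj := F.patchMap_surjective i j
  -- Defined through an arbitrary preimage; `hr` shows that `r` pulls back to `H / (x_i ^ P * y_j ^
  -- Q)`, which gives regularity.
  let r : F.space.induced (F.patch i j) → ℂ := fun y => evalAt (Function.surjInv hsurj y) p
  have hr : ∀ (z : (affineSpace (Fin (n + 1) ⊕ Fin (m + 1))).induced
      (nonvanishingLocus F.irrelevantIdeal)) (hz : F.pointClass z ∈ F.patch i j),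
      evalAt z.1 H = evalAt z.1 (X (Sum.inl i)) ^ P * evalAt z.1 (X (Sum.inr j)) ^ Q *
        r ⟨F.pointClass z, hz⟩ := by
    intro z hz
    set x := Function.surjInv hsurj ⟨F.pointClass z, hz⟩
    have h : F.pointClass z = F.pointClass ⟨slice i j x, F.slice_mem i j x⟩ :=
      congrArg Subtype.val (Function.surjInv_eq hsurj ⟨F.pointClass z, hz⟩).symm
    exact hH z.1 x ((F.pointClass_eq_iff (z' := ⟨slice i j x, F.slice_mem i j x⟩)).1 h)
  refine ⟨fun y => r y, fun y => ⟨⟨F.patch i j, F.isOpen_patch i j⟩, y.1.2,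
    fun v => r ⟨v.1, v.2⟩, fun z => ?_, fun _ _ => rfl⟩, fun x => ?_⟩
  · let B : MvPolynomial (Fin (n + 1) ⊕ Fin (m + 1)) ℂ := X (Sum.inl i) ^ P * X (Sum.inr j) ^ Q
    let D : Opens (affineSpace (Fin (n + 1) ⊕ Fin (m + 1))) := ⟨_, isOpen_evalAt_ne_zero B⟩
    have hB : ∀ z : (affineSpace (Fin (n + 1) ⊕ Fin (m + 1))).induced
        (nonvanishingLocus F.irrelevantIdeal), F.pointClass z ∈ F.patch i j →
        evalAt z.1 B ≠ 0 := by
      intro z hz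
      have := F.pointClass_mem_patch_iff.1 hz
      rw [map_mul, map_pow, map_pow]
      exact mul_ne_zero (pow_ne_zero _ (left_ne_zero_of_mul this))
        (pow_ne_zero _ (right_ne_zero_of_mul this))
    refine ⟨D, hB z.1 z.2, _, mul_mem (evalAt_mem_affineSpace_regular H D)
      ((affineSpace_isLocallyRinged _).inv_mem D _ (evalAt_mem_affineSpace_regular B D)
        fun y => y.2), fun y _ => ?_⟩
    change r ⟨F.pointClass y.1, y.2⟩ = evalAt y.1.1 H * (evalAt y.1.1 B)⁻¹
    rw [eq_mul_inv_iff_mul_eq₀ (hB y.1 y.2), hr y.1 y.2, map_mul, map_pow, map_pow, mul_comm]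
  · have := hr ⟨slice i j x, F.slice_mem i j x⟩ (F.patchMap i j x).2
    rw [hH _ x ⟨1, 1, one_ne_zero, one_ne_zero, fun _ => by rw [one_mul],
      fun _ => by rw [one_pow, one_pow]⟩, evalAt_slice_inl, evalAt_slice_inr, one_pow, one_pow,
      one_mul, one_mul, one_mul] at this
    exact this.symm

theorem space_isLocallyRinged : F.space.IsLocallyRinged :=
  ((affineSpace_isLocallyRinged _).induced _).quotient _

theorem isQuotientMorphism_patchMap : IsQuotientMorphism (F.patchMap i j) :=
  have : NeZero (F.a j) := ⟨(F.a_pos j).ne'⟩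
  isQuotientMorphism_of_isCyclicInvariant (k := F.a j) (w := F.patchWeight j)
    (F.space_isLocallyRinged.induced _) (F.isMorphism_patchMap i j) (F.patchMap_surjective i j)
    (fun _ hε x => F.patchMap_weightedScale i j x hε)
    fun _ hp => F.exists_regular_comp_patchMap i j hp

/-- No stabilizer computation is needed for the forward direction: invariant polynomials factor
through `patchMap` and separate the orbits. -/
theorem patchMap_eq_iff {x y : affineSpace (Fin (n + m))} :
    F.patchMap i j x = F.patchMap i j y ↔
      ∃ ε : ℂ, ε ^ F.a j = 1 ∧ x = weightedScale (F.patchWeight j) ε y := by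
  have : NeZero (F.a j) := ⟨(F.a_pos j).ne'⟩
  constructor
  · intro h
    refine exists_eq_weightedScale fun p hp => ?_
    obtain ⟨r, -, hr⟩ := F.exists_regular_comp_patchMap i j hp
    simp only [← hr, h]
  · rintro ⟨ε, hε, rfl⟩
    exact F.patchMap_weightedScale i j y hε

end Patch

end WeightedBundle

end

theorem proposition3p3 {n m : ℕ} (F : WeightedBundle n m) :
    (⋃ ij : Fin (n + 1) × Fin (m + 1), F.patch ij.1 ij.2) = Set.univ ∧
    Function.Injective (fun ij : Fin (n + 1) × Fin (m + 1) => F.patch ij.1 ij.2) ∧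
    ∀ (i : Fin (n + 1)) (j : Fin (m + 1)),
      IsOpen (F.patch i j) ∧
      (F.space.induced (F.patch i j)).IsAffine ∧
      Nonempty ((F.space.induced (F.patch i j)).Iso
        (cyclicQuotient (F.a j)
          (Fin.append (fun _ : Fin n => 0) (fun k : Fin m => F.a (j.succAbove k))))) := by
  refine ⟨F.iUnion_patch, F.patch_injective, fun i j => ⟨F.isOpen_patch i j, ?_, ?_⟩⟩
  · have : NeZero (F.a j) := ⟨(F.a_pos j).ne'⟩
    obtain ⟨M, I, φ, hφ, h⟩ := exists_affine_quotientMorphism (F.a j) (F.patchWeight j)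
    exact ⟨M, I, (F.isQuotientMorphism_patchMap i j).nonempty_iso hφ fun x y =>
      (F.patchMap_eq_iff i j).trans (h x y).symm⟩
  · have : NeZero (F.a j) := ⟨(F.a_pos j).ne'⟩
    exact (F.isQuotientMorphism_patchMap i j).nonempty_iso
      (SpaceWithFunctions.isQuotientMorphism_mk _) fun x y => (F.patchMap_eq_iff i j).trans
        (diagonalOrbitRel_rootsOfUnity_iff.symm.trans Quotient.eq.symm)
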